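/- Let $n,k$ be integers with $2\le k\le n-1$. For $\lambda\in\mathbb{R}^n$ let $\sigma_j(\lambda)=\sum_{1\le i_1<\cdots<i_j\le n}\lambda_{i_1}\cdots\lambda_{i_j}$, let $\Gamma_n=\{\lambda\in\mathbb{R}^n:\lambda_j>0,\ j=1,\dots,n\}$ be the positive cone, and let $f_k(\lambda)=\log\sigma_k(\lambda)$ on $\Gamma_n$, with second-order differential $d^2f_k(\lambda,\xi)=\sum_{i,j=1}^n\frac{\partial^2 f_k}{\partial\lambda_i\partial\lambda_j}(\lambda)\,\xi_i\xi_j$ for $\xi\in\mathbb{R}^n$. Let $0<\gamma_k<1$ be such that - if $k\in\{2,3,4,n-2,n-1\}$, then $\gamma_k\in(0,1)$ is arbitrary; - if $k$ is not one of these values and $[\frac n2]+1\le k\le n-3$, then $\gamma_k=\frac{n-k}{k}$; - if $k$ is not one of these values and $5\le k\le[\frac n2]$, then $\gamma_k=\frac{k-2}{n-(k-2)}$. Let $\Sigma_{(\gamma_k)}$ be the set of all $\lambda\in\Gamma_n$ with $\min_{1\le j\le n}\lambda_j\ge\gamma_k\max_{1\le j\le n}\lambda_j$. Then there is a constant $\gamma^{(k)}>0$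 (which may depend on $n$, $k$ and $\gamma_k$) such that $$d^2f_k(\lambda,\lambda\eta)\le-\gamma^{(k)}|\eta|^2\qquad\text{for all }\lambda\in\Sigma_{(\gamma_k)}\text{ and all }\eta\in\mathbb{R}^n,$$ where $\lambda\eta=(\lambda_1\eta_1,\dots,\lambda_n\eta_n)$ and $|\cdot|$ is the Euclidean norm. -/

import Mathlib

/-- The elementary symmetric polynomial `σ_k(x) = ∑_{i₁ < ⋯ < i_k} x_{i₁} ⋯ x_{i_k}`. -/
noncomputable def sigma {n : ℕ} (k : ℕ) (x : EuclideanSpace ℝ (Fin n)) : ℝ :=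
  ∑ s ∈ Finset.powersetCard k (Finset.univ : Finset (Fin n)), ∏ i ∈ s, x i

theorem sigma_eq_eval_esymm {n : ℕ} (k : ℕ) (x : EuclideanSpace ℝ (Fin n)) :
    sigma k x = MvPolynomial.eval (fun i => x i) (MvPolynomial.esymm (Fin n) ℝ k) := by
  simp [sigma, MvPolynomial.esymm, map_sum, map_prod]

/-- The positive cone `Γ_n = {x ∈ ℝⁿ : x_j > 0 for all j}`. -/
def positiveCone (n : ℕ) : Set (EuclideanSpace ℝ (Fin n)) :=
  {x | ∀ j, 0 < x j}

/-- The function `f_k = log σ_k`. -/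
noncomputable def logSigma {n : ℕ} (k : ℕ) (x : EuclideanSpace ℝ (Fin n)) : ℝ :=
  Real.log (sigma k x)

/-- The second-order differential `d²f(x, ξ) = ∑_{i,j} ∂²f/∂x_i∂x_j (x) ξ_i ξ_j`. -/
noncomputable def secondDifferential {n : ℕ} (f : EuclideanSpace ℝ (Fin n) → ℝ)
    (x ξ : EuclideanSpace ℝ (Fin n)) : ℝ :=
  iteratedFDeriv ℝ 2 f x ![ξ, ξ]

/-- The coordinatewise product `xη = (x₁η₁, …, x_nη_n)`. -/
noncomputable def coordMul {n : ℕ} (x η : EuclideanSpace ℝ (Fin n)) :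
    EuclideanSpace ℝ (Fin n) :=
  WithLp.toLp 2 (fun i => x i * η i)

/-- The conditions on the number `γ_k ∈ (0, 1)`: it is arbitrary in `(0, 1)` for
`k ∈ {2, 3, 4, n - 2, n - 1}`, and it has a prescribed value for the other `k`. -/
structure AdmissibleGamma (n k : ℕ) (γ : ℝ) : Prop where
  pos : 0 < γ
  lt_one : γ < 1
  upper : ¬ (k = 2 ∨ k = 3 ∨ k = 4 ∨ k + 2 = n ∨ k + 1 = n) →
    n / 2 + 1 ≤ k → k + 3 ≤ n → γ = ((n : ℝ) - k) / k
  lower : ¬ (k = 2 ∨ k = 3 ∨ k = 4 ∨ k + 2 = n ∨ k + 1 = n) →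
    5 ≤ k → k ≤ n / 2 → γ = ((k : ℝ) - 2) / (n - (k - 2))

/-- The set of all `x ∈ Γ_n` with `x_min ≥ γ x_max`. -/
def sigmaCone (n : ℕ) (γ : ℝ) : Set (EuclideanSpace ℝ (Fin n)) :=
  {x | x ∈ positiveCone n ∧ (⨅ i, x i) ≥ γ * ⨆ i, x i}

/-! By Marcus–Lopes, each quotient σ_{j+1}/σ_j is concave on the positive cone, hence so is its
logarithm. Telescoping, log σ_k - log σ_2 is concave for k ≥ 2, so d² log σ_k ≤ d² log σ_2 and only
k = 2 needs a quantitative bound (`secondDifferential_logSigma_le`).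

For σ_2 the Hessian is explicit. With a = ∑ x_i and s = (∑ v_i)/a, completing squares gives d² log
σ_2(x, v) ≤ -(s² + 2 ∑ (v_i - s x_i)²/a²) (`secondDifferential_logSigma_two_le`). For v = xη the
deviations are x_i(η_i - s), and the pinching of the coordinates gives x_i/a ≥ γ/n. The right side
thus controls both s² and ∑ (η_i - s)², hence |η|². -/

/-- The elementary symmetric polynomial of degree `k` in the variables indexed by `T`. -/
noncomputable def esymmOn {ι : Type*} (T : Finset ι) (k : ℕ) (x : ι → ℝ) : ℝ :=
  ∑ s ∈ T.powersetCard k, ∏ i ∈ s, x i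

/-! ### Elementary symmetric polynomials on subsets of the variables -/

section EsymmOn

variable {ι : Type*}

@[simp]
theorem esymmOn_zero (T : Finset ι) (x : ι → ℝ) : esymmOn T 0 x = 1 := by
  simp [esymmOn]

theorem esymmOn_one (T : Finset ι) (x : ι → ℝ) : esymmOn T 1 x = ∑ i ∈ T, x i := by
  simp [esymmOn, Finset.powersetCard_one]

theorem esymmOn_insert [DecidableEq ι] {T : Finset ι} {a : ι} (ha : a ∉ T) (k : ℕ) (x : ι → ℝ) :
    esymmOn (insert a T) (k + 1) x = esymmOn T (k + 1) x + x a * esymmOn T k x := by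
  unfold esymmOn
  rw [Finset.powersetCard_succ_insert ha, Finset.sum_union, Finset.sum_image, Finset.mul_sum]
  · congr 1
    refine Finset.sum_congr rfl fun s hs => ?_
    rw [Finset.prod_insert fun h => ha ((Finset.mem_powersetCard.1 hs).1 h)]
  · intro s hs t ht h
    have hs' : a ∉ s := fun h => ha ((Finset.mem_powersetCard.1 hs).1 h)
    have ht' : a ∉ t := fun h => ha ((Finset.mem_powersetCard.1 ht).1 h)
    rw [← Finset.erase_insert hs', ← Finset.erase_insert ht']
    exact congrArg (fun u => Finset.erase u a) h
  · rw [Finset.disjoint_left]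
    intro s hs hs'
    obtain ⟨t, -, rfl⟩ := Finset.mem_image.1 hs'
    exact ha ((Finset.mem_powersetCard.1 hs).1 (Finset.mem_insert_self a t))

/-- Each monomial of degree k + 1 arises once for each of its k + 1 variables. -/
theorem sum_mul_esymmOn_erase [DecidableEq ι] (T : Finset ι) (k : ℕ) (x : ι → ℝ) :
    ∑ i ∈ T, x i * esymmOn (T.erase i) k x = (k + 1) * esymmOn T (k + 1) x := by
  induction T using Finset.induction_on generalizing k with
  | empty =>
    have h : (∅ : Finset ι).powersetCard (k + 1) = ∅ := Finset.powersetCard_eq_empty.2 (by simp)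
    simp [esymmOn, h]
  | insert a T ha ih =>
    cases k with
    | zero => simp [esymmOn_one]
    | succ k =>
      rw [Finset.sum_insert ha, Finset.erase_insert ha, esymmOn_insert ha]
      have h : ∀ i ∈ T, x i * esymmOn ((insert a T).erase i) (k + 1) x =
          x i * esymmOn (T.erase i) (k + 1) x + x a * (x i * esymmOn (T.erase i) k x) := by
        intro i hi
        have hne : a ≠ i := fun h => ha (h ▸ hi)
        rw [Finset.erase_insert_of_ne hne,
          esymmOn_insert fun h => ha (Finset.mem_of_mem_erase h)]
        ring
      rw [Finset.sum_congr rfl h, Finset.sum_add_distrib, ← Finset.mul_sum, ih, ih]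
      push_cast
      ring

theorem two_mul_esymmOn_two (T : Finset ι) (x : ι → ℝ) :
    2 * esymmOn T 2 x = (∑ i ∈ T, x i) ^ 2 - ∑ i ∈ T, x i ^ 2 := by
  classical
  have h := sum_mul_esymmOn_erase T 1 x
  have h' : ∀ i ∈ T, x i * esymmOn (T.erase i) 1 x = x i * (∑ j ∈ T, x j) - x i ^ 2 := by
    intro i hi
    rw [esymmOn_one, ← Finset.add_sum_erase T x hi]
    ring
  rw [Finset.sum_congr rfl h', Finset.sum_sub_distrib, ← Finset.sum_mul] at h
  push_cast at h
  linarith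

theorem esymmOn_nonneg {T : Finset ι} (k : ℕ) {x : ι → ℝ} (hx : ∀ i, 0 < x i) :
    0 ≤ esymmOn T k x :=
  Finset.sum_nonneg fun _ _ => Finset.prod_nonneg fun i _ => (hx i).le

theorem esymmOn_pos {T : Finset ι} {k : ℕ} (hk : k ≤ T.card) {x : ι → ℝ} (hx : ∀ i, 0 < x i) :
    0 < esymmOn T k x :=
  Finset.sum_pos (fun _ _ => Finset.prod_pos fun i _ => hx i)
    (Finset.powersetCard_nonempty.2 hk)

end EsymmOn

/-! ### Concavity of quotients and of their logarithms -/

/-- uv/(u + v) is the minimum over t of t²u + (1 - t)²v, attained at t = v/(u + v), and an infimum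
of concave functions is concave. -/
theorem ConcaveOn.mul_div_add {E : Type*} [AddCommMonoid E] [Module ℝ E] {s : Set E} {f g : E → ℝ}
    (hf : ConcaveOn ℝ s f) (hg : ConcaveOn ℝ s g) (hf0 : ∀ x ∈ s, 0 < f x)
    (hg0 : ∀ x ∈ s, 0 ≤ g x) : ConcaveOn ℝ s fun x => f x * g x / (f x + g x) := by
  refine ⟨hf.1, fun x hx y hy a b ha hb hab => ?_⟩
  have key : ∀ u v t : ℝ, 0 < u → 0 ≤ v → u * v / (u + v) ≤ t ^ 2 * u + (1 - t) ^ 2 * v := by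
    intro u v t hu hv
    rw [div_le_iff₀ (by positivity)]
    nlinarith [sq_nonneg (t * u - (1 - t) * v)]
  have hz : a • x + b • y ∈ s := hf.1 hx hy ha hb hab
  have h1 := hf.2 hx hy ha hb hab
  have h2 := hg.2 hx hy ha hb hab
  have hfz := hf0 _ hz
  have hgz := hg0 _ hz
  simp only [smul_eq_mul] at h1 h2 ⊢
  set u := f (a • x + b • y)
  set v := g (a • x + b • y)
  have heq : u * v / (u + v) = (v / (u + v)) ^ 2 * u + (1 - v / (u + v)) ^ 2 * v := by
    have : u + v ≠ 0 := by positivity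
    field_simp
    ring
  rw [heq]
  set t := v / (u + v)
  have k1 := mul_le_mul_of_nonneg_left (key (f x) (g x) t (hf0 x hx) (hg0 x hx)) ha
  have k2 := mul_le_mul_of_nonneg_left (key (f y) (g y) t (hf0 y hy) (hg0 y hy)) hb
  have k3 := mul_le_mul_of_nonneg_left h1 (sq_nonneg t)
  have k4 := mul_le_mul_of_nonneg_left h2 (sq_nonneg (1 - t))
  linarith

theorem convex_setOf_forall_pos (ι : Type*) : Convex ℝ {x : ι → ℝ | ∀ i, 0 < x i} := by
  have : {x : ι → ℝ | ∀ i, 0 < x i} = Set.univ.pi fun _ => Set.Ioi 0 := by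
    ext; simp
  rw [this]
  exact convex_pi fun _ _ => convex_Ioi 0

theorem concaveOn_finset_sum {E α : Type*} [AddCommMonoid E] [Module ℝ E] {s : Set E}
    (hs : Convex ℝ s) (T : Finset α) {f : α → E → ℝ} (hf : ∀ i ∈ T, ConcaveOn ℝ s (f i)) :
    ConcaveOn ℝ s fun x => ∑ i ∈ T, f i x := by
  classical
  induction T using Finset.induction_on with
  | empty => simpa using concaveOn_const 0 hs
  | insert a T ha ih =>
    simp only [Finset.sum_insert ha]
    exact (hf a (Finset.mem_insert_self a T)).add
      (ih fun i hi => hf i (Finset.mem_insert_of_mem hi))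

/-- The Marcus–Lopes theorem: quotients of consecutive elementary symmetric polynomials are concave
on the positive cone. -/
theorem concaveOn_esymmOn_div {ι : Type*} (k : ℕ) {T : Finset ι} (hk : k ≤ T.card) :
    ConcaveOn ℝ {x : ι → ℝ | ∀ i, 0 < x i} fun x => esymmOn T (k + 1) x / esymmOn T k x := by
  classical
  have hproj : ∀ i, ConcaveOn ℝ {x : ι → ℝ | ∀ i, 0 < x i} fun x => x i := fun i =>
    (LinearMap.proj (R := ℝ) (φ := fun _ : ι => ℝ) i).concaveOn (convex_setOf_forall_pos ι)
  induction k generalizing T with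
  | zero =>
    simp only [esymmOn_one, esymmOn_zero, zero_add, div_one]
    exact concaveOn_finset_sum (convex_setOf_forall_pos ι) T fun i _ => hproj i
  | succ k ih =>
    have hcard : ∀ i ∈ T, k ≤ (T.erase i).card := by
      intro i hi
      rw [Finset.card_erase_of_mem hi]
      omega
    -- With q_i = σ_{k+1}/σ_k in the variables other than x_i, the identity behind the induction is
    -- (k + 2) σ_{k+2}/σ_{k+1} = ∑ x_i q_i/(x_i + q_i).
    have hsum := concaveOn_finset_sum (convex_setOf_forall_pos ι) T fun i hi =>
      (hproj i).mul_div_add (ih (hcard i hi)) (fun x hx => hx i) fun x hx =>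
        div_nonneg (esymmOn_nonneg (k + 1) hx) (esymmOn_nonneg k hx)
    refine (hsum.smul (c := ((k : ℝ) + 2)⁻¹) (by positivity)).congr fun x hx => ?_
    have hpos := esymmOn_pos hk hx
    have hrec := sum_mul_esymmOn_erase T (k + 1) x
    have hterm : ∀ i ∈ T, x i * (esymmOn (T.erase i) (k + 1) x / esymmOn (T.erase i) k x) /
        (x i + esymmOn (T.erase i) (k + 1) x / esymmOn (T.erase i) k x) =
        x i * esymmOn (T.erase i) (k + 1) x / esymmOn T (k + 1) x := by
      intro i hi
      have h0 := esymmOn_pos (hcard i hi) hx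
      have hT : esymmOn T (k + 1) x =
          esymmOn (T.erase i) (k + 1) x + x i * esymmOn (T.erase i) k x := by
        rw [← esymmOn_insert (Finset.notMem_erase i T), Finset.insert_erase hi]
      have h1 : x i + esymmOn (T.erase i) (k + 1) x / esymmOn (T.erase i) k x =
          esymmOn T (k + 1) x / esymmOn (T.erase i) k x := by
        rw [hT]
        field_simp
        ring
      rw [h1]
      field_simp
    simp only [smul_eq_mul]
    rw [Finset.sum_congr rfl hterm, ← Finset.sum_div, hrec]
    push_cast
    field_simp
    ring

theorem ConcaveOn.log_of_pos {E : Type*} [AddCommMonoid E] [Module ℝ E] {s : Set E} {f : E → ℝ}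
    (hf : ConcaveOn ℝ s f) (hf0 : ∀ x ∈ s, 0 < f x) : ConcaveOn ℝ s fun x => Real.log (f x) := by
  refine ⟨hf.1, fun x hx y hy a b ha hb hab => ?_⟩
  refine (strictConcaveOn_log_Ioi.concaveOn.2 (hf0 x hx) (hf0 y hy) ha hb hab).trans ?_
  refine Real.log_le_log ?_ (hf.2 hx hy ha hb hab)
  exact (convex_Ioi (0 : ℝ)) (hf0 x hx) (hf0 y hy) ha hb hab

theorem concaveOn_log_esymmOn_sub {ι : Type*} {T : Finset ι} {j k : ℕ} (hjk : j ≤ k)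
    (hk : k ≤ T.card) :
    ConcaveOn ℝ {x : ι → ℝ | ∀ i, 0 < x i} fun x =>
      Real.log (esymmOn T k x) - Real.log (esymmOn T j x) := by
  induction k, hjk using Nat.le_induction with
  | base => simpa using concaveOn_const 0 (convex_setOf_forall_pos ι)
  | succ k hjk ih =>
    have hlog := (concaveOn_esymmOn_div k (Nat.le_of_succ_le hk)).log_of_pos fun x hx =>
      div_pos (esymmOn_pos hk hx) (esymmOn_pos (Nat.le_of_succ_le hk) hx)
    refine ((ih (Nat.le_of_succ_le hk)).add hlog).congr fun x hx => ?_
    simp only [Pi.add_apply]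
    rw [Real.log_div (esymmOn_pos hk hx).ne' (esymmOn_pos (Nat.le_of_succ_le hk) hx).ne']
    ring

/-! ### Second differentials through restriction to lines -/

section SecondDifferential

open Topology

variable {n : ℕ} {f : EuclideanSpace ℝ (Fin n) → ℝ} {x v : EuclideanSpace ℝ (Fin n)}

theorem hasDerivAt_add_smul (x v : EuclideanSpace ℝ (Fin n)) (t : ℝ) :
    HasDerivAt (fun t : ℝ => x + t • v) v t := by
  simpa using ((hasDerivAt_id t).smul_const v).const_add x

theorem ContDiffAt.hasDerivAt_deriv_line (hf : ContDiffAt ℝ 2 f x)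
    (v : EuclideanSpace ℝ (Fin n)) :
    HasDerivAt (deriv fun t : ℝ => f (x + t • v)) (secondDifferential f x v) 0 := by
  have hx : x + (0 : ℝ) • v = x := by simp
  have htend : Filter.Tendsto (fun t : ℝ => x + t • v) (𝓝 0) (𝓝 x) := by
    simpa using (hasDerivAt_add_smul x v 0).continuousAt.tendsto
  have hd : deriv (fun t : ℝ => f (x + t • v)) =ᶠ[𝓝 0] fun t => fderiv ℝ f (x + t • v) v := by
    filter_upwards [htend.eventually (hf.eventually (by simp))] with t ht
    exact ((ht.differentiableAt (by simp)).hasFDerivAt.comp_hasDerivAt t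
      (hasDerivAt_add_smul x v t)).deriv
  have h2 : HasFDerivAt (fderiv ℝ f) (fderiv ℝ (fderiv ℝ f) x) (x + (0 : ℝ) • v) := by
    rw [hx]
    exact ((hf.fderiv_right (m := 1) (by norm_num)).differentiableAt (by simp)).hasFDerivAt
  have h3 : HasDerivAt (fun t : ℝ => fderiv ℝ f (x + t • v)) (fderiv ℝ (fderiv ℝ f) x v) 0 :=
    h2.comp_hasDerivAt (0 : ℝ) (hasDerivAt_add_smul x v 0)
  have h4 : secondDifferential f x v = fderiv ℝ (fderiv ℝ f) x v v := by
    rw [secondDifferential, iteratedFDeriv_two_apply]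
    rfl
  rw [h4]
  refine HasDerivAt.congr_of_eventuallyEq ?_ hd
  exact (ContinuousLinearMap.apply ℝ ℝ v).hasFDerivAt.comp_hasDerivAt (0 : ℝ) h3

theorem ConcaveOn.secondDifferential_nonpos {s : Set (EuclideanSpace ℝ (Fin n))}
    (hf : ConcaveOn ℝ s f) (hs : IsOpen s) (hfs : ContDiffOn ℝ 2 f s) (hx : x ∈ s)
    (v : EuclideanSpace ℝ (Fin n)) : secondDifferential f x v ≤ 0 := by
  set D : Set ℝ := (fun t : ℝ => x + t • v) ⁻¹' s
  have hD : IsOpen D := hs.preimage (by fun_prop)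
  have h0 : (0 : ℝ) ∈ D := by simpa [D] using hx
  have hline : (AffineMap.lineMap x (x + v) : ℝ → EuclideanSpace ℝ (Fin n)) =
      fun t => x + t • v := by
    ext1 t
    simp [AffineMap.lineMap_apply, add_comm]
  have hc : ConcaveOn ℝ D fun t : ℝ => f (x + t • v) := by
    have := hf.comp_affineMap (AffineMap.lineMap x (x + v) : ℝ →ᵃ[ℝ] EuclideanSpace ℝ (Fin n))
    rwa [hline] at this
  have hanti := hc.antitoneOn_deriv fun t ht =>
    (((hfs.contDiffAt (hs.mem_nhds ht)).differentiableAt (by simp)).hasFDerivAt.comp_hasDerivAt t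
      (hasDerivAt_add_smul x v t)).differentiableAt
  have hder := (hfs.contDiffAt (hs.mem_nhds hx)).hasDerivAt_deriv_line v
  -- The sign of the derivative within `D` needs 0 to be an accumulation point of `D`.
  refine hder.hasDerivWithinAt.nonpos_of_antitoneOn ?_ hanti
  simpa using (PerfectSpace.univ_preperfect (0 : ℝ) (Set.mem_univ 0)).nhds_inter (hD.mem_nhds h0)

/-- Applied to σ_2, whose restriction to every line is a quadratic polynomial; this avoids partial
derivatives. -/
theorem secondDifferential_log_of_quadratic {p : EuclideanSpace ℝ (Fin n) → ℝ} {b c : ℝ}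
    (hp : 0 < p x) (hp2 : ContDiffAt ℝ 2 p x)
    (hline : ∀ t : ℝ, p (x + t • v) = p x + b * t + c / 2 * t ^ 2) :
    secondDifferential (fun y => Real.log (p y)) x v = (c * p x - b ^ 2) / p x ^ 2 := by
  have h1 := (hp2.log hp.ne').hasDerivAt_deriv_line v
  have hq : ∀ t : ℝ, HasDerivAt (fun t : ℝ => p x + b * t + c / 2 * t ^ 2) (b + c * t) t := by
    intro t
    have := (((hasDerivAt_id t).const_mul b).const_add (p x)).add
      ((hasDerivAt_pow 2 t).const_mul (c / 2))
    refine this.congr_deriv ?_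
    push_cast
    ring
  have hd : (deriv fun t : ℝ => Real.log (p (x + t • v))) =ᶠ[𝓝 0]
      fun t => (b + c * t) / (p x + b * t + c / 2 * t ^ 2) := by
    have hev : ∀ᶠ t : ℝ in 𝓝 0, 0 < p x + b * t + c / 2 * t ^ 2 :=
      continuousAt_const.eventually_lt (hq 0).continuousAt (by simpa using hp)
    filter_upwards [hev] with t ht
    simp only [hline]
    exact ((hq t).log ht.ne').deriv
  have hlin : HasDerivAt (fun t : ℝ => b + c * t) c 0 := by
    simpa using ((hasDerivAt_id (0 : ℝ)).const_mul c).const_add b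
  have h2 := (hlin.div (hq 0) (by simpa using hp.ne')).congr_of_eventuallyEq hd
  rw [h1.unique h2]
  simp
  ring

end SecondDifferential

/-! ### Comparison with σ_2 and its explicit Hessian -/

section SigmaCalculus

variable {n : ℕ}

theorem sigma_eq_esymmOn (k : ℕ) (x : EuclideanSpace ℝ (Fin n)) :
    sigma k x = esymmOn Finset.univ k fun i => x i :=
  rfl

theorem sigma_pos {k : ℕ} (hk : k ≤ n) {x : EuclideanSpace ℝ (Fin n)}
    (hx : x ∈ positiveCone n) : 0 < sigma k x :=
  esymmOn_pos (by simpa using hk) hx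

theorem contDiff_sigma (k : ℕ) : ContDiff ℝ 2 (sigma (n := n) k) := by
  unfold sigma
  fun_prop

theorem isOpen_positiveCone : IsOpen (positiveCone n) := by
  have : positiveCone n = ⋂ j, {x : EuclideanSpace ℝ (Fin n) | 0 < x j} := by
    ext; simp [positiveCone]
  rw [this]
  exact isOpen_iInter_of_finite fun j => isOpen_lt continuous_const (by fun_prop)

theorem contDiffOn_logSigma {k : ℕ} (hk : k ≤ n) :
    ContDiffOn ℝ 2 (logSigma k) (positiveCone n) :=
  (contDiff_sigma k).contDiffOn.log fun _ hx => (sigma_pos hk hx).ne'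

theorem concaveOn_logSigma_sub {j k : ℕ} (hjk : j ≤ k) (hk : k ≤ n) :
    ConcaveOn ℝ (positiveCone n) (logSigma k - logSigma j) :=
  (concaveOn_log_esymmOn_sub (T := (Finset.univ : Finset (Fin n))) hjk
    (by simpa using hk)).comp_linearMap (WithLp.linearEquiv 2 ℝ (Fin n → ℝ)).toLinearMap

theorem secondDifferential_logSigma_le {j k : ℕ} (hjk : j ≤ k) (hk : k ≤ n)
    {x : EuclideanSpace ℝ (Fin n)} (hx : x ∈ positiveCone n) (v : EuclideanSpace ℝ (Fin n)) :
    secondDifferential (logSigma k) x v ≤ secondDifferential (logSigma j) x v := by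
  have hj := contDiffOn_logSigma (hjk.trans hk)
  have hk' := contDiffOn_logSigma hk
  have hsub := (concaveOn_logSigma_sub hjk hk).secondDifferential_nonpos isOpen_positiveCone
    (hk'.sub hj) hx v
  have hjx := hj.contDiffAt (isOpen_positiveCone.mem_nhds hx)
  have hkx := hk'.contDiffAt (isOpen_positiveCone.mem_nhds hx)
  have hadd : secondDifferential (logSigma j + (logSigma k - logSigma j)) x v =
      secondDifferential (logSigma j) x v + secondDifferential (logSigma k - logSigma j) x v := by
    unfold secondDifferential
    rw [iteratedFDeriv_add_apply hjx (g := logSigma k - logSigma j) (hkx.sub hjx)]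
    rfl
  rw [add_sub_cancel] at hadd
  linarith

theorem secondDifferential_logSigma_two (hn : 2 ≤ n) {x : EuclideanSpace ℝ (Fin n)}
    (hx : x ∈ positiveCone n) (v : EuclideanSpace ℝ (Fin n)) :
    secondDifferential (logSigma 2) x v =
      (((∑ i, v i) ^ 2 - ∑ i, v i ^ 2) * sigma 2 x -
        ((∑ i, x i) * (∑ i, v i) - ∑ i, x i * v i) ^ 2) / sigma 2 x ^ 2 := by
  refine secondDifferential_log_of_quadratic (sigma_pos hn hx) (contDiff_sigma 2).contDiffAt
    fun t => ?_
  have h1 := two_mul_esymmOn_two Finset.univ fun i => x i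
  have h2 := two_mul_esymmOn_two Finset.univ fun i => (x + t • v) i
  rw [← sigma_eq_esymmOn] at h1 h2
  have h3 : ∑ i, (x + t • v) i = ∑ i, x i + t * ∑ i, v i := by
    simp [Finset.sum_add_distrib, Finset.mul_sum]
  have h4 : ∑ i, (x + t • v) i ^ 2 =
      ∑ i, x i ^ 2 + 2 * t * ∑ i, x i * v i + t ^ 2 * ∑ i, v i ^ 2 := by
    simp only [Finset.mul_sum, ← Finset.sum_add_distrib]
    refine Finset.sum_congr rfl fun i _ => ?_
    simp
    ring
  rw [h3, h4] at h2
  linarith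

theorem secondDifferential_logSigma_two_le (hn : 2 ≤ n) {x : EuclideanSpace ℝ (Fin n)}
    (hx : x ∈ positiveCone n) (v : EuclideanSpace ℝ (Fin n)) :
    secondDifferential (logSigma 2) x v ≤
      -(((∑ i, v i) / ∑ i, x i) ^ 2 +
        2 * (∑ i, (v i - (∑ i, v i) / (∑ i, x i) * x i) ^ 2) / (∑ i, x i) ^ 2) := by
  rw [secondDifferential_logSigma_two hn hx]
  have hp := sigma_pos hn hx
  have hp2 := two_mul_esymmOn_two Finset.univ fun i => x i
  rw [← sigma_eq_esymmOn] at hp2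
  have ha : 0 < ∑ i, x i := by
    have : Nonempty (Fin n) := ⟨⟨0, by omega⟩⟩
    exact Finset.sum_pos (fun i _ => hx i) Finset.univ_nonempty
  have hb : 0 ≤ ∑ i, x i ^ 2 := Finset.sum_nonneg fun i _ => sq_nonneg _
  obtain ⟨s, hs⟩ : ∃ s, s = (∑ i, v i) / ∑ i, x i := ⟨_, rfl⟩
  have hS : ∑ i, v i = s * ∑ i, x i := by rw [hs]; field_simp
  rw [← hs, hS]
  have hW : ∑ i, (v i - s * x i) ^ 2 =
      ∑ i, v i ^ 2 - 2 * s * ∑ i, x i * v i + s ^ 2 * ∑ i, x i ^ 2 := by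
    simp only [Finset.mul_sum, ← Finset.sum_add_distrib, ← Finset.sum_sub_distrib]
    exact Finset.sum_congr rfl fun i _ => by ring
  have hW0 : 0 ≤ ∑ i, (v i - s * x i) ^ 2 := Finset.sum_nonneg fun i _ => sq_nonneg _
  set W := ∑ i, (v i - s * x i) ^ 2
  set a := ∑ i, x i
  set b := ∑ i, x i ^ 2
  set m := ∑ i, x i * v i
  set p := sigma 2 x
  -- Substituting a² = 2p + b completes the squares; the middle square is discarded at the end.
  have hnum : ((s * a) ^ 2 - ∑ i, v i ^ 2) * p - (a * (s * a) - m) ^ 2 =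
      -(s ^ 2 * p ^ 2) - (s * p + (s * b - m)) ^ 2 - W * p := by
    have hb' : a ^ 2 = 2 * p + b := by linarith
    have e1 : (s * a) ^ 2 = s ^ 2 * (2 * p + b) := by rw [← hb']; ring
    have e2 : a * (s * a) = s * (2 * p + b) := by rw [← hb']; ring
    rw [e1, e2, hW]
    ring
  -- This is p ≤ a²/2, since b ≥ 0.
  have hWp : 2 * W / a ^ 2 ≤ W / p := by
    rw [div_le_div_iff₀ (by positivity) hp]
    nlinarith
  rw [hnum, div_le_iff₀ (by positivity)]
  have hWp' : 2 * W / a ^ 2 * p ^ 2 ≤ W * p := by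
    calc 2 * W / a ^ 2 * p ^ 2 ≤ W / p * p ^ 2 := by gcongr
      _ = W * p := by field_simp
  nlinarith [sq_nonneg (s * p + (s * b - m))]

theorem mul_sum_le_of_mem_sigmaCone {γ : ℝ} (hγ : 0 ≤ γ) {x : EuclideanSpace ℝ (Fin n)}
    (hx : x ∈ sigmaCone n γ) (i : Fin n) : γ * ∑ j, x j ≤ n * x i := by
  have h1 : ∀ j, x j ≤ ⨆ j, x j := fun j => le_ciSup (Set.finite_range fun j => x j).bddAbove j
  have h2 : ⨅ j, x j ≤ x i := ciInf_le (Set.finite_range fun j => x j).bddBelow i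
  calc γ * ∑ j, x j ≤ γ * (n * ⨆ j, x j) := by
        gcongr
        simpa using Finset.sum_le_card_nsmul Finset.univ (fun j => x j) _ fun j _ => h1 j
    _ = n * (γ * ⨆ j, x j) := by ring
    _ ≤ n * x i := by gcongr; exact hx.2.trans h2

end SigmaCalculus

/-! ### The uniform estimate on the pinched cone -/

theorem theorem4p1 (n k : ℕ) (hk2 : 2 ≤ k) (hkn : k + 1 ≤ n) (γ : ℝ)
    (hγ : AdmissibleGamma n k γ) :
    ∃ c : ℝ, 0 < c ∧
      ∀ x ∈ sigmaCone n γ, ∀ η : EuclideanSpace ℝ (Fin n),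
        secondDifferential (logSigma k) x (coordMul x η) ≤ -c * ‖η‖ ^ 2 := by
  have hγ0 := hγ.pos
  have hn3 : (3 : ℝ) ≤ n := by exact_mod_cast (by omega : 3 ≤ n)
  refine ⟨γ ^ 2 / n ^ 2, by positivity, fun x hx η => ?_⟩
  refine (secondDifferential_logSigma_le hk2 (by omega) hx.1 _).trans
    ((secondDifferential_logSigma_two_le (by omega) hx.1 _).trans ?_)
  rw [neg_mul, neg_le_neg_iff]
  have ha : 0 < ∑ i, x i := by
    have : Nonempty (Fin n) := ⟨⟨0, by omega⟩⟩
    exact Finset.sum_pos (fun i _ => hx.1 i) Finset.univ_nonempty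
  set a := ∑ i, x i
  set s := (∑ i, coordMul x η i) / a
  have hV : γ ^ 2 / n ^ 2 * ∑ i, (η i - s) ^ 2 ≤
      (∑ i, (coordMul x η i - s * x i) ^ 2) / a ^ 2 := by
    rw [Finset.mul_sum, Finset.sum_div]
    refine Finset.sum_le_sum fun i _ => ?_
    have hi := mul_sum_le_of_mem_sigmaCone hγ0.le hx i
    have hle : γ / n ≤ x i / a := by
      rw [div_le_div_iff₀ (by positivity) ha]
      linarith
    calc γ ^ 2 / n ^ 2 * (η i - s) ^ 2 = (γ / n) ^ 2 * (η i - s) ^ 2 := by rw [div_pow]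
      _ ≤ (x i / a) ^ 2 * (η i - s) ^ 2 := by gcongr
      _ = (coordMul x η i - s * x i) ^ 2 / a ^ 2 := by
        simp only [coordMul]
        ring
  have hη : ‖η‖ ^ 2 ≤ 2 * (∑ i, (η i - s) ^ 2) + 2 * n * s ^ 2 := by
    have hconst : 2 * n * s ^ 2 = ∑ _i : Fin n, 2 * s ^ 2 := by
      simp
      ring
    rw [EuclideanSpace.real_norm_sq_eq, hconst, Finset.mul_sum, ← Finset.sum_add_distrib]
    exact Finset.sum_le_sum fun i _ => by nlinarith [sq_nonneg (η i - 2 * s)]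
  -- The coefficient of s² must not exceed 1; this amounts to 2γ² ≤ n.
  have hc : γ ^ 2 / n ^ 2 * (2 * n) ≤ 1 := by
    rw [div_mul_eq_mul_div, div_le_one (by positivity)]
    nlinarith [hγ.lt_one, pow_le_one₀ hγ0.le hγ.lt_one.le (n := 2)]
  calc γ ^ 2 / n ^ 2 * ‖η‖ ^ 2
      ≤ γ ^ 2 / n ^ 2 * (2 * (∑ i, (η i - s) ^ 2) + 2 * n * s ^ 2) := by gcongr
    _ = γ ^ 2 / n ^ 2 * (2 * n) * s ^ 2 + 2 * (γ ^ 2 / n ^ 2 * ∑ i, (η i - s) ^ 2) := by ring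
    _ ≤ 1 * s ^ 2 + 2 * ((∑ i, (coordMul x η i - s * x i) ^ 2) / a ^ 2) := by gcongr
    _ = _ := by ring
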